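/- All varieties are over $\mathbb C$. For an affine variety $V$ let $F(V)$ be its field of rational functions, and $LND(\mathcal O(V))$ the set of locally nilpotent derivations of $\mathcal O(V)$, i.e. derivations for which every element is killed by some iterate; $ML(V)\subseteq\mathcal O(V)$ is the set of elements killed by all of them. A smooth affine rational surface $S$ is rigid if its logarithmic Kodaira dimension is $-\infty$ and $ML(S)=\mathcal O(S)$. A generalized locally nilpotent derivation of $S$ is a derivation $\partial$ of $F(S)$ such that, for some $f_0\in F(S)$ with $\partial f_0=0$, it maps the ring $\mathcal O(S)[f_0]$ to itself and is locally nilpotent on it; put $F(S)^{\partial}=\{h\in F(S):\partial h=0\}$. A line bundle $\pi:L\to S$ with local fibre coordinates $t_\alpha$ over a covering $(U_\alpha)$ is associated to a divisor $D$ on $S$ if there are rational functions $h_\alpha$ with $t_\alpha/t_\beta=h_\alpha/h_\beta$ and $D|_{U_\alpha}=(h_\alpha)|_{U_\alpha}$. Lemma. Let $S$ be a rigid surface and $\partial$ a generalized locally nilpotent derivation of $S$. There are a line bundle $\pi:L\to S$ and a non-zero $\partial'\in LND(\mathcal O(L))$ such that (the extension of $\partial'$ to $F(L)$ satisfies) $\partial'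 g=0$ for every $g\in\pi^*(F(S)^{\partial})$. Moreover, if $\partial\neq0$, then there is $f\in F(S)$ with $F(S)^{\partial}=\mathbb C(f)$, and if $f$ is a morphism $S\to\mathbb P^1$ (that is, $\partial$ is induced by a fibration over $\mathbb P^1$), then $L$ is associated to the divisor $-mF$ for some integer $m\ge1$, where $F=(f)_\infty$ is the fibre of $f$ over $\infty$, and $\partial'$ is not identically zero on $\pi^*\mathcal O(S)$. -/

import Mathlib

open scoped TensorProduct

noncomputable section

namespace GMLBundle

open AlgebraicGeometry CategoryTheory

/-! ### Locally nilpotent derivations and the invariant `ML` -/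

/-- A derivation of a complex algebra is locally nilpotent (an lnd) if every element is killed by
some iterate. -/
def IsLocallyNilpotent {B : Type*} [CommRing B] [Algebra ℂ B] (D : Derivation ℂ B B) : Prop :=
  ∀ b : B, ∃ n : ℕ, D^[n] b = 0

/-- `ML(R)`: the elements of `R` that are killed by all locally nilpotent derivations of `R`. -/
def ML (R : Type*) [CommRing R] [Algebra ℂ R] : Set R :=
  {a | ∀ D : Derivation ℂ R R, IsLocallyNilpotent D → D a = 0}

/-- A derivation `D` of the field of fractions `F(R)` is a generalized locally nilpotent derivation
(a glnd) of `R` if for some `f ∈ F(R)` with `D f = 0` it maps the ring `R[f] ⊆ F(R)` to itself and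
is locally nilpotent there. -/
def IsGLND (R : Type*) [CommRing R] [IsDomain R] [Algebra ℂ R]
    (D : Derivation ℂ (FractionRing R) (FractionRing R)) : Prop :=
  ∃ f : FractionRing R, D f = 0 ∧
    ∀ b ∈ Algebra.adjoin R {f},
      D b ∈ Algebra.adjoin R {f} ∧ ∃ n : ℕ, D^[n] b = 0

/-! ### Logarithmic Kodaira dimension `-∞` -/

/-- The complement of the open subset `U` of `X` is a divisor with strict normal crossings: at each
point `x` there is a regular system of parameters `z₁, …, z_d` of the local ring such that the
complement of `U` is given near `x` by `z₁ ⋯ z_r = 0` for some `r ≤ d`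
(with `r = 0` when `x ∈ U`). -/
def IsSNCComplement (X : Scheme.{0}) (U : X.Opens) : Prop :=
  ∀ x : X, ∃ (d r : ℕ) (z : Fin d → X.presheaf.stalk x),
    ringKrullDim (X.presheaf.stalk x) = d ∧ r ≤ d ∧
    Ideal.span (Set.range z) = IsLocalRing.maximalIdeal (X.presheaf.stalk x) ∧
    ∀ q : Spec (X.presheaf.stalk x),
      X.fromSpecStalk x q ∉ U ↔
        (∏ i ∈ (Finset.univ : Finset (Fin d)).filter (fun i : Fin d => (i : ℕ) < r), z i) ∈
          PrimeSpectrum.asIdeal q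

/-- A smooth complete variety `X` over `ℂ` that contains `Spec R` as the complement of a divisor
with strict normal crossings. -/
structure SNCCompletion (R : Type) [CommRing R] [Algebra ℂ R] where
  X : Scheme.{0}
  str : X ⟶ Spec (CommRingCat.of ℂ)
  j : Spec (CommRingCat.of R) ⟶ X
  isIntegral : IsIntegral X
  isProper : IsProper str
  smooth : Smooth str
  isOpenImmersion : IsOpenImmersion j
  comm : j ≫ str = Spec.map (CommRingCat.ofHom (algebraMap ℂ R))
  snc : IsSNCComplement X j.opensRange

namespace SNCCompletion

variable {R : Type} [CommRing R] [Algebra ℂ R] (C : SNCCompletion R)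

instance : IsIntegral C.X := C.isIntegral

instance : IsOpenImmersion C.j := C.isOpenImmersion

/-- The function field `F` of `X`. -/
abbrev K : Type := C.X.functionField

instance : Nonempty (⊤ : C.X.Opens) := ⟨⟨Classical.arbitrary C.X, trivial⟩⟩

/-- The function field is a complex algebra through the structure morphism of `X`. -/
instance : Algebra ℂ C.K :=
  ((Scheme.ΓSpecIso (CommRingCat.of ℂ)).inv ≫ C.str.appTop ≫
    C.X.germToFunctionField ⊤).hom.toAlgebra

/-- The rational `n`-canonical forms on the surface `X`: the `n`-th tensor power over `F` of
`⋀² Ω_{F/ℂ}`. -/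
abbrev PluriForm (n : ℕ) : Type := ⨂[C.K]^n (⋀[C.K]^2 (Ω[C.K⁄ℂ]))

/-- The `n`-canonical forms that are regular at the point `x`: the sums of terms
`c • (da₁ ∧ db₁) ⊗ ⋯ ⊗ (daₙ ∧ dbₙ)` with `c, aᵢ, bᵢ` in the local ring at `x`. -/
def regularForms (n : ℕ) (x : C.X) : AddSubgroup (C.PluriForm n) :=
  AddSubgroup.closure {ω | ∃ (c : C.X.presheaf.stalk x) (a b : Fin n → C.X.presheaf.stalk x),
    ω = (algebraMap (C.X.presheaf.stalk x) C.K c) •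
      PiTensorProduct.tprod C.K (fun i => exteriorPower.ιMulti C.K 2
        ![KaehlerDifferential.D ℂ C.K (algebraMap (C.X.presheaf.stalk x) C.K (a i)),
          KaehlerDifferential.D ℂ C.K (algebraMap (C.X.presheaf.stalk x) C.K (b i))])}

/-- `ω` is a global section of `n (K_X + D)`, where `D` is the reduced boundary `X ∖ Spec R`: it is
regular at the points of codimension one of `Spec R` and has a pole of order at most `n` along each
component of `D`. -/
def IsLogForm (n : ℕ) (ω : C.PluriForm n) : Prop :=
  ∀ x : C.X, Order.coheight x = 1 →
    (x ∈ C.j.opensRange → ω ∈ C.regularForms n x) ∧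
    (x ∉ C.j.opensRange → ∀ t ∈ IsLocalRing.maximalIdeal (C.X.presheaf.stalk x),
      (algebraMap (C.X.presheaf.stalk x) C.K t) ^ n • ω ∈ C.regularForms n x)

end SNCCompletion

/-- The logarithmic Kodaira dimension of the surface `Spec R` is `-∞`: all the logarithmic
plurigenera `h⁰(X, n (K_X + D))`, `n ≥ 1`, of a completion `X` with boundary `D` vanish. (They do
not depend on the completion, and there is one by resolution of singularities.) -/
def LogKodairaDimNegInfty (R : Type) [CommRing R] [Algebra ℂ R] : Prop :=
  ∃ C : SNCCompletion R, ∀ n : ℕ, 1 ≤ n → ∀ ω : C.PluriForm n, C.IsLogForm n ω → ω = 0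

/-- `R` is the ring `𝒪(S)` of a rigid surface `S`: a smooth affine rational complex surface with
logarithmic Kodaira dimension `-∞` and `ML(S) = 𝒪(S)`. -/
structure IsRigidSurface (R : Type) [CommRing R] [IsDomain R] [Algebra ℂ R] : Prop where
  smooth : Algebra.Smooth ℂ R
  dim : ringKrullDim R = 2
  rational : Nonempty (FractionRing R ≃ₐ[ℂ] FractionRing (MvPolynomial (Fin 2) ℂ))
  logKodaira : LogKodairaDimNegInfty R
  ml : ML R = Set.univ

/-! ### Orders of vanishing, divisors, and morphisms to `ℙ¹` -/

section Divisors

variable {R : Type} [CommRing R] [IsDomain R]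

/-- The order of a rational function `h = a / b ≠ 0` (with `a, b ∈ R`) along the prime divisor given
by a prime ideal `p` of height one: `length (R_p / a R_p) - length (R_p / b R_p)`. It does not
depend on the choice of `a` and `b`. -/
def ordAt (p : PrimeSpectrum R) (h : FractionRing R) : ℤ :=
  let ab := IsLocalization.sec (nonZeroDivisors R) h
  ((Ring.ord (Localization.AtPrime p.asIdeal) (algebraMap R _ ab.1)).toNat : ℤ) -
    ((Ring.ord (Localization.AtPrime p.asIdeal) (algebraMap R _ (ab.2 : R))).toNat : ℤ)

/-- The divisor of poles `(f)_∞`, as a function on prime divisors. If `f` is a morphism to `ℙ¹`,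
this is the fibre of `f` over `∞`. -/
def polarDivisor (f : FractionRing R) (p : PrimeSpectrum R) : ℤ :=
  max 0 (-ordAt p f)

/-- The rational function `f` is a morphism `Spec R ⟶ ℙ¹`: at each point `p` it can be written as
`[a : b]` with `a, b` regular and not both vanishing at `p`. -/
def IsMorphismToP1 (f : FractionRing R) : Prop :=
  ∀ p : PrimeSpectrum R, ∃ a b : R, (a ∉ p.asIdeal ∨ b ∉ p.asIdeal) ∧
    f * algebraMap R (FractionRing R) b = algebraMap R (FractionRing R) a

end Divisors

/-! ### Line bundles -/

/-- A line bundle `π : L ⟶ S` of affine varieties, `S = Spec R`, `L = Spec total`. There is a finite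
covering of `S` by principal open sets `Uᵢ = {rᵢ ≠ 0}` with `𝒪(π⁻¹ Uᵢ) = 𝒪(Uᵢ)[tᵢ]` a polynomial
ring, and `tᵢ / tⱼ` is an invertible regular function on `Uᵢ ∩ Uⱼ`. All these rings are considered
as subrings of the field of rational functions of `L`. -/
structure LineBundle (R : Type) [CommRing R] [Algebra ℂ R] where
  total : Type
  [commRing : CommRing total]
  [isDomain : IsDomain total]
  [algebraC : Algebra ℂ total]
  [algebra : Algebra R total]
  [tower : IsScalarTower ℂ R total]
  injective : Function.Injective (algebraMap R total)
  n : ℕ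
  r : Fin n → R
  r_ne_zero : ∀ i, r i ≠ 0
  cover : Ideal.span (Set.range r) = ⊤
  t : Fin n → FractionRing total
  t_transcendental : ∀ i, Transcendental R (t i)
  trivial : ∀ i,
    (Algebra.adjoin total {(algebraMap R (FractionRing total) (r i))⁻¹}).restrictScalars R =
      Algebra.adjoin R {(algebraMap R (FractionRing total) (r i))⁻¹, t i}
  transition : ∀ i j,
    ∃ g : (Algebra.adjoin R {(algebraMap R (FractionRing total) (r i * r j))⁻¹})ˣ,
      t i = (g : Algebra.adjoin R {(algebraMap R (FractionRing total) (r i * r j))⁻¹}) * t j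

namespace LineBundle

attribute [instance] commRing isDomain algebraC algebra tower

variable {R : Type} [CommRing R] [IsDomain R] [Algebra ℂ R] (L : LineBundle R)

/-- The pullback `π^* : F(S) ⟶ F(L)` of rational functions. -/
def pullback : FractionRing R →+* FractionRing L.total :=
  IsFractionRing.lift (A := R) (g := algebraMap R (FractionRing L.total)) (by
    rw [IsScalarTower.algebraMap_eq R L.total (FractionRing L.total)]
    exact (IsFractionRing.injective L.total (FractionRing L.total)).comp L.injective)

/-- The divisor `D` on `S` is associated to the line bundle: there are rational functions `hᵢ` with
`tᵢ / tⱼ = hᵢ / hⱼ` and `D|Uᵢ = (hᵢ)|Uᵢ`. -/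
def IsAssociated (D : PrimeSpectrum R → ℤ) : Prop :=
  ∃ h : Fin L.n → FractionRing R, (∀ i, h i ≠ 0) ∧
    (∀ i j, L.t i / L.t j = L.pullback (h i / h j)) ∧
    ∀ i, ∀ p : PrimeSpectrum R, p.asIdeal.height = 1 → L.r i ∉ p.asIdeal → ordAt p (h i) = D p

end LineBundle

/-- `x ∈ F(B)` is killed by the (unique) extension of the derivation `D` of `B` to the field of
fractions `F(B)`. -/
def KillsFraction {B : Type*} [CommRing B] [IsDomain B] [Algebra ℂ B] (D : Derivation ℂ B B)
    (x : FractionRing B) : Prop :=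
  ∃ E : Derivation ℂ (FractionRing B) (FractionRing B),
    (∀ b : B, E (algebraMap B (FractionRing B) b) = algebraMap B (FractionRing B) (D b)) ∧ E x = 0

end GMLBundle

end

/-! Suppose first that `D ≠ 0`. The field of constants `K` of `D` is generated by one element. Since
`D` is zero on any algebraic extension of `K`, the function field is transcendental over `K`, so `K`
has transcendence degree at most one over `ℂ`. If `K` is larger than `ℂ`, take a nonconstant `u ∈ K`
and restrict to a curve `y = x ^ N` on which `u` stays nonconstant. Then `ℂ(u)`, and by integrality
all of `K`, lies in the power series ring `ℂ(x)⟦y - x ^ N⟧`. The constant coefficient embeds `K`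
into `ℂ(x)`, and Lüroth's theorem gives `K = ℂ(f)` (`exists_algHom_ratFunc`,
`exists_constants_eq_adjoin`).

If `f` is a morphism to `ℙ¹`, the bundle has coordinate ring `R[X, f X, …, f ^ m X]`
(`P1Cover.bundle`): its fibre coordinate is `X` where `f` is regular and `f ^ m X` where `1 / f` is,
so its local equations `1` and `f ^ m` define `-m F`. Here `D` maps `R` into `R[f₀]` with `f₀ ∈
ℂ(f)`. As `R` is finitely generated, one constant `q ≠ 0` and one `m` give `q D(r) X ∈ R[X, …, f ^ m
X]` for all `r` (`exists_clearing_denominators`). So `q X D`, with `D` acting on coefficients,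
preserves the ring. Its `n`-th iterate sends `r` to `q ^ n D ^ n(r) X ^ n`, whence local nilpotency,
and it kills the constants of `D`.

If `D = 0` or `f` is not a morphism, the derivative along the fibres of the trivial bundle suffices:
it kills every pullback. -/

namespace GMLBundle

open Polynomial

/-! ### The field of constants of a derivation of a rational function field in two variables -/

section Constants

variable {k E : Type} [Field k] [Field E] [Algebra k E]

/-- The field of constants of a derivation of a field. -/
def constants (D : Derivation k E E) : IntermediateField k E where
  carrier := {h | D h = 0}
  mul_mem' {a b} ha hb := by
    simp only [Set.mem_ofPred_eq] at *
    simp [ha, hb]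
  add_mem' {a b} ha hb := by
    simp only [Set.mem_ofPred_eq] at *
    simp [ha, hb]
  algebraMap_mem' r := by simp
  inv_mem' a ha := by
    simp only [Set.mem_ofPred_eq] at *
    simp [Derivation.leibniz_inv, ha]

theorem mem_constants {D : Derivation k E E} {h : E} : h ∈ constants D ↔ D h = 0 := Iff.rfl

/-- A derivation as a derivation over its field of constants. -/
def overConstants (D : Derivation k E E) : Derivation (constants D) E E where
  toFun := D
  map_add' := by simp
  map_smul' a b := by
    have h : D (a : E) = 0 := a.2
    simp [Algebra.smul_def, IntermediateField.algebraMap_apply, h]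
  map_one_eq_zero' := by simp
  leibniz' := by simp

/-- If `h` were algebraic over the constants with minimal polynomial `p`, applying `D` to `p(h) = 0`
gives `p'(h) D h = 0`, and `p'(h) ≠ 0` by separability. -/
theorem transcendental_constants [CharZero k] {D : Derivation k E E} (hD : D ≠ 0) :
    Algebra.Transcendental (constants D) E := by
  by_contra hcon
  rw [Algebra.transcendental_iff_not_isAlgebraic, not_not] at hcon
  have : CharZero E := charZero_of_injective_algebraMap (algebraMap k E).injective
  apply hD
  ext h
  have hint : IsIntegral (constants D) h := (hcon.isAlgebraic h).isIntegral
  have h1 := (overConstants D).map_aeval (minpoly (constants D) h) h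
  rw [minpoly.aeval, map_zero] at h1
  have h2 : aeval h (derivative (minpoly (constants D) h)) ≠ 0 :=
    (minpoly.irreducible hint).separable.aeval_derivative_ne_zero (minpoly.aeval _ _)
  exact (smul_eq_zero.mp h1.symm).resolve_left h2

/-- In the tower `k ⊆ k(u) ⊆ constants D ⊆ E` the bottom and top steps each have transcendence
degree at least one, which leaves nothing for the middle. -/
theorem isAlgebraic_adjoin_of_trdeg_le_two [CharZero k] (hE : Algebra.trdeg k E ≤ 2)
    {D : Derivation k E E} (hD : D ≠ 0) {u : E} (hu : u ∈ constants D)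
    (hut : Transcendental k u) {v : E} (hv : v ∈ constants D) :
    IsAlgebraic (IntermediateField.adjoin k {u}) v := by
  have hle : IntermediateField.adjoin k {u} ≤ constants D := by
    rw [IntermediateField.adjoin_simple_le_iff]; exact hu
  let := (IntermediateField.inclusion hle).toRingHom.toAlgebra
  have : IsScalarTower k (IntermediateField.adjoin k {u}) (constants D) :=
    IsScalarTower.of_algebraMap_eq fun x => rfl
  have : IsScalarTower (IntermediateField.adjoin k {u}) (constants D) E :=
    IsScalarTower.of_algebraMap_eq fun x => rfl
  have := transcendental_constants hD
  have : Algebra.Transcendental k (IntermediateField.adjoin k {u}) := by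
    refine ⟨⟨⟨u, IntermediateField.mem_adjoin_simple_self k u⟩, fun h => hut ?_⟩⟩
    exact h.algebraMap (A := E)
  have h1 : 0 < Algebra.trdeg (constants D) E := trdeg_pos _ _
  have h2 : 0 < Algebra.trdeg k (IntermediateField.adjoin k {u}) := trdeg_pos _ _
  have e1 := trdeg_add_eq k (constants D) (A := E)
  have : FaithfulSMul (IntermediateField.adjoin k {u}) (constants D) :=
    (faithfulSMul_iff_algebraMap_injective _ _).mpr (RingHom.injective _)
  have e2 := trdeg_add_eq k (IntermediateField.adjoin k {u}) (A := constants D)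
  have h3 : Algebra.trdeg (IntermediateField.adjoin k {u}) (constants D) = 0 := by
    rw [← e1, ← e2] at hE
    generalize Algebra.trdeg (constants D) E = a at *
    generalize Algebra.trdeg k (IntermediateField.adjoin k {u}) = b at *
    generalize Algebra.trdeg (IntermediateField.adjoin k {u}) (constants D) = c at *
    have hlt : b + c + a < Cardinal.aleph0 := hE.trans_lt (Cardinal.natCast_lt_aleph0 (n := 2))
    obtain ⟨hbc, ha⟩ := Cardinal.add_lt_aleph0_iff.mp hlt
    obtain ⟨hb, hc⟩ := Cardinal.add_lt_aleph0_iff.mp hbc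
    lift a to ℕ using ha
    lift b to ℕ using hb
    lift c to ℕ using hc
    norm_cast at *
    omega
  have := trdeg_eq_zero_iff.mp h3
  exact (this.isAlgebraic ⟨v, hv⟩).algebraMap (A := E)

end Constants

/-! ### Specialization to a curve -/

section Specialization

variable {k : Type} [Field k]

/-- Kronecker substitution: with coefficients of degree below `N`, the terms of `G` occupy disjoint
ranges of exponents after `y = x ^ N`. The proof strips the lowest coefficient, which is divisible
by `X ^ N` but too short to be nonzero. -/
theorem eq_zero_of_eval_X_pow_eq_zero {N : ℕ} {G : k[X][X]} (hN : ∀ i, (G.coeff i).natDegree < N)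
    (h : G.eval (X ^ N) = 0) : G = 0 := by
  by_contra hG
  induction hd : G.natDegree using Nat.strong_induction_on generalizing G with
  | _ d ih =>
    have h0 : G.coeff 0 = 0 := by
      by_contra hne
      have hdvd : (X : k[X]) ^ N ∣ G.coeff 0 := by
        have := G.sub_dvd_eval_sub (X ^ N) 0
        rw [h, ← coeff_zero_eq_eval_zero] at this
        simpa using this
      have := Polynomial.natDegree_le_of_dvd hdvd hne
      rw [natDegree_X_pow] at this
      exact absurd (hN 0) (by omega)
    obtain ⟨H, rfl⟩ := X_dvd_iff.mpr h0
    have hH : H ≠ 0 := right_ne_zero_of_mul hG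
    refine ih H.natDegree ?_ (fun i => by simpa using hN (i + 1)) ?_ hH rfl
    · rw [← hd, natDegree_X_mul hH]; omega
    · rw [eval_mul, eval_X] at h
      exact (mul_eq_zero.mp h).resolve_left (pow_ne_zero _ X_ne_zero)

theorem exists_natDegree_coeff_le (P : k[X][X]) : ∃ n, ∀ i, (P.coeff i).natDegree ≤ n := by
  refine ⟨P.support.sup fun i => (P.coeff i).natDegree, fun i => ?_⟩
  by_cases hi : i ∈ P.support
  · exact Finset.le_sup (f := fun i => (P.coeff i).natDegree) hi
  · simp [notMem_support_iff.mp hi]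

/-- A single `N` serves every `c`, because scaling `Q` by a constant does not raise the degrees of
its coefficients. -/
theorem exists_X_pow_specialization (P Q : k[X][X]) :
    ∃ N : ℕ, (∀ c : k, P.eval (X ^ N) = C c * Q.eval (X ^ N) → P = C (C c) * Q) ∧
      (Q.eval (X ^ N) = 0 → Q = 0) := by
  obtain ⟨n, hn⟩ := exists_natDegree_coeff_le P
  obtain ⟨m, hm⟩ := exists_natDegree_coeff_le Q
  refine ⟨max n m + 1, fun c hc => ?_, eq_zero_of_eval_X_pow_eq_zero fun i => ?_⟩
  swap
  · have := hm i
    omega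
  rw [← sub_eq_zero]
  refine eq_zero_of_eval_X_pow_eq_zero (N := max n m + 1) (fun i => ?_) ?_
  · rw [coeff_sub, coeff_C_mul]
    refine lt_of_le_of_lt (natDegree_sub_le _ _) ?_
    have := hn i
    have := (natDegree_C_mul_le c (Q.coeff i)).trans (hm i)
    omega
  · rw [eval_sub, eval_mul, eval_C, hc, sub_self]

/-- The expansion of a polynomial in two variables along the curve `y = g(x)`. -/
noncomputable def expandAlong (g : k[X]) : k[X][X] →+* PowerSeries (RatFunc k) :=
  (coeToPowerSeries.ringHom).comp
    ((taylorAlgHom (algebraMap k[X] (RatFunc k) g)).toRingHom.comp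
      (mapRingHom (algebraMap k[X] (RatFunc k))))

theorem expandAlong_injective (g : k[X]) : Function.Injective (expandAlong g) := by
  refine (Polynomial.coe_injective _).comp ((taylor_injective _).comp ?_)
  exact map_injective _ (IsFractionRing.injective _ _)

theorem constantCoeff_expandAlong (g : k[X]) (P : k[X][X]) :
    PowerSeries.constantCoeff (expandAlong g P) = algebraMap k[X] (RatFunc k) (P.eval g) := by
  simp [expandAlong, taylor_coeff_zero, eval_map, eval₂_at_apply]

theorem expandAlong_C_C (g : k[X]) (c : k) :
    expandAlong g (C (C c)) = PowerSeries.C (RatFunc.C c) := by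
  simp [expandAlong]

end Specialization

theorem RingHom.exists_lift_of_mem_range {A B S : Type*} [CommRing A] [CommRing B] [CommRing S]
    {i : A →+* B} (hi : Function.Injective i) {φ : S →+* B} (h : ∀ s, φ s ∈ i.range) :
    ∃ g : S →+* A, i.comp g = φ := by
  choose g hg using h
  refine ⟨{ toFun := g, map_one' := ?_, map_mul' := ?_, map_zero' := ?_, map_add' := ?_ }, ?_⟩
  · exact hi (by simp [hg])
  · exact fun x y => hi (by simp [hg])
  · exact hi (by simp [hg])
  · exact fun x y => hi (by simp [hg])
  · ext s; simp [hg]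

/-! ### Embedding a field of constants into `k(x)` -/

section FieldSpecialization

variable {k E : Type} [Field k] [Field E] [Algebra k E] [Algebra k[X][X] E]
  [IsFractionRing k[X][X] E] [IsScalarTower k k[X][X] E]

omit [IsFractionRing k[X][X] E] in
theorem algebraMap_C_C (c : k) : algebraMap k[X][X] E (C (C c)) = algebraMap k E c := by
  rw [IsScalarTower.algebraMap_apply k k[X][X] E]; rfl

/-- Two-variable rational functions that are algebraic over `k(u)` embed into the rational
functions in one variable, by restriction to a curve. -/
theorem exists_algHom_ratFunc (K : IntermediateField k E) {u : E}
    (hu : u ∉ (algebraMap k E).range)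
    (hK : ∀ v ∈ K, IsAlgebraic (IntermediateField.adjoin k {u}) v) :
    Nonempty (K →ₐ[k] RatFunc k) := by
  obtain ⟨P, Q, hQ, rfl⟩ := IsFractionRing.div_surjective (A := k[X][X]) u
  have hQ0 : Q ≠ 0 := nonZeroDivisors.ne_zero hQ
  obtain ⟨N, hN, hQN⟩ := exists_X_pow_specialization P Q
  set u := algebraMap k[X][X] E P / algebraMap k[X][X] E Q with hu_def
  have hinj : Function.Injective (algebraMap k[X][X] E) := IsFractionRing.injective _ _
  let i : PowerSeries (RatFunc k) →+* LaurentSeries (RatFunc k) := algebraMap _ _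
  have hi : Function.Injective i := IsFractionRing.injective _ _
  let φ : E →+* LaurentSeries (RatFunc k) :=
    IsFractionRing.lift (g := i.comp (expandAlong (X ^ N))) (hi.comp (expandAlong_injective _))
  have hφ : ∀ G, φ (algebraMap k[X][X] E G) = i (expandAlong (X ^ N) G) :=
    fun G => IsFractionRing.lift_algebraMap _ _
  have hφC : ∀ c : k, φ (algebraMap k E c) = i (PowerSeries.C (RatFunc.C c)) := fun c => by
    rw [← algebraMap_C_C, hφ, expandAlong_C_C]
  have hQc : PowerSeries.constantCoeff (expandAlong (X ^ N) Q) ≠ 0 := by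
    rw [constantCoeff_expandAlong]
    exact fun h => hQ0 (hQN ((map_eq_zero_iff _ (IsFractionRing.injective _ _)).mp h))
  set U : PowerSeries (RatFunc k) :=
    expandAlong (X ^ N) P * (expandAlong (X ^ N) Q)⁻¹ with hU
  have hUQ : U * expandAlong (X ^ N) Q = expandAlong (X ^ N) P := by
    rw [hU, mul_assoc, PowerSeries.inv_mul_cancel _ hQc, mul_one]
  have hφu : φ u = i U := by
    rw [hu_def, map_div₀, hφ, hφ, ← hUQ, map_mul, mul_div_cancel_right₀]
    rw [Ne, map_eq_zero_iff _ hi, map_eq_zero_iff _ (expandAlong_injective _)]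
    exact hQ0
  -- The restriction of `u` to the curve is nonconstant: if it were `c`, the choice of `N` would
  -- force `P = c Q`, hence `u = c`.
  have hU0 : Transcendental k (PowerSeries.constantCoeff U) := by
    refine RatFunc.transcendental_of_ne_C _ fun ⟨c, hc⟩ => hu ?_
    have h1 := congrArg PowerSeries.constantCoeff hUQ
    rw [map_mul, constantCoeff_expandAlong, constantCoeff_expandAlong, hc,
      ← RatFunc.algebraMap_C, ← map_mul] at h1
    have h2 := hN c (IsFractionRing.injective k[X] (RatFunc k) h1).symm
    refine ⟨c, ?_⟩
    rw [hu_def, h2, map_mul, algebraMap_C_C, mul_div_cancel_right₀]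
    rwa [Ne, map_eq_zero_iff _ hinj]
  -- A nonzero polynomial in `u` has nonzero constant coefficient by transcendence, so it expands to
  -- a unit and may be inverted inside the power series.
  have hφp : ∀ p : k[X], ∃ W, φ (aeval u p) = i W ∧ (p ≠ 0 → IsUnit W) := by
    intro p
    refine ⟨eval₂ (PowerSeries.C.comp RatFunc.C) U p, ?_, fun hp => ?_⟩
    · rw [aeval_def, hom_eval₂, hom_eval₂, hφu]
      congr 1
      ext c
      simp [hφC]
    · rw [PowerSeries.isUnit_iff_constantCoeff, isUnit_iff_ne_zero, hom_eval₂]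
      have := (transcendental_iff.mp hU0 p).mt hp
      rw [aeval_def] at this
      have hcomp : (PowerSeries.constantCoeff (R := RatFunc k)).comp
          (PowerSeries.C.comp RatFunc.C) = algebraMap k (RatFunc k) := by
        ext c
        simp [RatFunc.algebraMap_eq_C]
      rw [hcomp]
      exact this
  have hk : ∀ w : IntermediateField.adjoin k {u},
      φ.comp (algebraMap (IntermediateField.adjoin k {u}) E) w ∈ i.range := by
    rintro ⟨w, hw⟩
    obtain ⟨r, s, rfl⟩ := (IntermediateField.mem_adjoin_simple_iff k w).mp hw
    change φ (aeval u r / aeval u s) ∈ i.range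
    obtain ⟨W, hW, -⟩ := hφp r
    obtain ⟨V, hV, hV0⟩ := hφp s
    by_cases hs : s = 0
    · exact ⟨0, by simp [hs]⟩
    obtain ⟨V', rfl⟩ := hV0 hs
    refine ⟨W * (V'⁻¹ : _ˣ), ?_⟩
    rw [map_div₀, hW, hV, map_mul, eq_div_iff, mul_assoc, ← map_mul, Units.inv_mul, map_one,
      mul_one]
    rw [Ne, map_eq_zero_iff _ hi]
    exact V'.ne_zero
  obtain ⟨g, hg⟩ := RingHom.exists_lift_of_mem_range hi hk
  -- Elements of `K` are integral over the field `k(u)`, and the power series ring is integrally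
  -- closed in the Laurent series.
  have hφK : ∀ v : K, φ.comp (algebraMap K E) v ∈ i.range := by
    rintro ⟨v, hv⟩
    obtain ⟨p, hp, hpv⟩ := (hK v hv).isIntegral
    refine IsIntegrallyClosed.isIntegral_iff.mp ⟨p.map g, hp.map g, ?_⟩
    change eval₂ i (φ v) _ = 0
    rw [eval₂_map, hg, ← hom_eval₂, hpv, map_zero]
  obtain ⟨G, hG⟩ := RingHom.exists_lift_of_mem_range hi hφK
  refine ⟨{ PowerSeries.constantCoeff.comp G with commutes' := fun c => ?_ }⟩
  have h1 : G (algebraMap k K c) = PowerSeries.C (RatFunc.C c) := by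
    apply hi
    rw [← hφC]
    exact congrArg (fun t : K →+* _ => t (algebraMap k K c)) hG
  change PowerSeries.constantCoeff (G (algebraMap k K c)) = _
  rw [h1, PowerSeries.constantCoeff_C, RatFunc.algebraMap_eq_C]

end FieldSpecialization

/-- The polynomial ring in two variables as an iterated polynomial ring. -/
noncomputable def mvPolynomialFinTwoEquiv (k : Type) [Field k] :
    MvPolynomial (Fin 2) k ≃ₐ[k] k[X][X] :=
  (MvPolynomial.finSuccEquiv k 1).trans (mapAlgEquiv (MvPolynomial.uniqueAlgEquiv k (Fin 1)))

/-- The field of constants of a nonzero derivation of a purely transcendental extension of degree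
two is generated by one element. -/
theorem exists_constants_eq_adjoin {k E : Type} [Field k] [IsAlgClosed k] [CharZero k] [Field E]
    [Algebra k E] (e : E ≃ₐ[k] FractionRing (MvPolynomial (Fin 2) k)) {D : Derivation k E E}
    (hD : D ≠ 0) : ∃ f, f ≠ 0 ∧ constants D = IntermediateField.adjoin k {f} := by
  by_cases hbot : constants D = ⊥
  -- The generator is taken to be `1` rather than `0`, since `f ≠ 0` is needed to build the bundle.
  · exact ⟨1, one_ne_zero, by rw [hbot, IntermediateField.adjoin_one]⟩
  obtain ⟨u, hu, hu'⟩ := SetLike.exists_of_lt (bot_lt_iff_ne_bot.mpr hbot)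
  have hur : u ∉ (algebraMap k E).range := fun h => hu' (IntermediateField.mem_bot.mpr h)
  have hut : Transcendental k u := by
    intro hu
    have := minpoly.degree_eq_one_iff (A := k) (x := u)
    exact hur (this.mp (IsAlgClosed.degree_eq_one_of_irreducible k
      (minpoly.irreducible hu.isIntegral)))
  have htr : Algebra.trdeg k E ≤ 2 := by
    rw [e.trdeg_eq, ← trdeg_add_eq k (MvPolynomial (Fin 2) k),
      MvPolynomial.trdeg_of_isDomain]
    have : Algebra.IsAlgebraic (MvPolynomial (Fin 2) k) (FractionRing (MvPolynomial (Fin 2) k)) :=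
      IsLocalization.isAlgebraic _ (nonZeroDivisors (MvPolynomial (Fin 2) k))
    rw [trdeg_eq_zero]
    simp
  let j : k[X][X] →ₐ[k] E := (e.symm.toAlgHom.comp
    (IsScalarTower.toAlgHom k (MvPolynomial (Fin 2) k) _)).comp
      (mvPolynomialFinTwoEquiv k).symm.toAlgHom
  let : Algebra k[X][X] E := j.toRingHom.toAlgebra
  have : IsScalarTower k k[X][X] E := IsScalarTower.of_algebraMap_eq fun x => (j.commutes x).symm
  have hj : Function.Injective j := by
    refine e.symm.injective.comp (Function.Injective.comp ?_ (AlgEquiv.injective _))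
    exact IsFractionRing.injective (MvPolynomial (Fin 2) k) _
  have : FaithfulSMul k[X][X] E := (faithfulSMul_iff_algebraMap_injective _ _).mpr hj
  have : IsFractionRing k[X][X] E := by
    refine IsFractionRing.of_field _ _ fun z => ?_
    obtain ⟨a, b, -, hab⟩ := IsFractionRing.div_surjective (A := MvPolynomial (Fin 2) k) (e z)
    refine ⟨mvPolynomialFinTwoEquiv k a, mvPolynomialFinTwoEquiv k b, ?_⟩
    change z = j _ / j _
    apply e.injective
    simp [j, hab]
  obtain ⟨ψ⟩ := exists_algHom_ratFunc (constants D) hur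
    fun v hv => isAlgebraic_adjoin_of_trdeg_le_two htr hD hu hut hv
  have hgen := RatFunc.Luroth.eq_adjoin_generator (E := ψ.fieldRange)
  have hmem : RatFunc.Luroth.generator ψ.fieldRange ∈ ψ.fieldRange :=
    hgen.ge (IntermediateField.mem_adjoin_simple_self _ _)
  obtain ⟨f, hf⟩ := hmem
  -- The Lüroth generator of the image is pulled back along the injective `ψ`.
  have htop : IntermediateField.adjoin k {f} = ⊤ := by
    apply IntermediateField.map_injective ψ
    rw [IntermediateField.adjoin_map, Set.image_singleton, ← AlgHom.fieldRange_eq_map, hgen]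
    congr 2
  have hE : constants D = IntermediateField.adjoin k {(f : E)} := by
    have := congrArg (IntermediateField.map (constants D).val) htop
    rw [IntermediateField.adjoin_map, Set.image_singleton, ← AlgHom.fieldRange_eq_map,
      IntermediateField.fieldRange_val] at this
    exact this.symm
  refine ⟨f, fun h0 => hbot ?_, hE⟩
  rw [hE, h0, IntermediateField.adjoin_zero]

noncomputable section

/-! ### The line bundle associated to a multiple of the fibre over infinity -/

section Bundle

variable {R : Type} [CommRing R]

/-- The ring `R[X, f X, …, f ^ m X]`. -/
def sectionRing (f : FractionRing R) (m : ℕ) : Subalgebra R (FractionRing R)[X] :=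
  Algebra.adjoin R {p | ∃ i ≤ m, p = C (f ^ i) * X}

theorem C_pow_mul_X_mem_sectionRing (f : FractionRing R) {m i : ℕ} (hi : i ≤ m) :
    C (f ^ i) * X ∈ sectionRing f m :=
  Algebra.subset_adjoin ⟨i, hi, rfl⟩

theorem algebraMap_sectionRing_injective (f : FractionRing R) (m : ℕ) :
    Function.Injective (algebraMap R (sectionRing f m)) := by
  intro x y h
  have h1 : algebraMap R (FractionRing R)[X] x = algebraMap R (FractionRing R)[X] y :=
    congrArg Subtype.val h
  rw [Polynomial.algebraMap_apply, Polynomial.algebraMap_apply] at h1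
  exact IsFractionRing.injective R (FractionRing R) (C_injective h1)

/-- The element `f ^ i X` as a rational function on the line bundle. -/
def sectionGen (f : FractionRing R) {m i : ℕ} (hi : i ≤ m) : FractionRing (sectionRing f m) :=
  algebraMap (sectionRing f m) _ ⟨C (f ^ i) * X, C_pow_mul_X_mem_sectionRing f hi⟩

theorem algebraMap_fractionRing_sectionRing_injective (f : FractionRing R) (m : ℕ) :
    Function.Injective (algebraMap R (FractionRing (sectionRing f m))) := by
  rw [IsScalarTower.algebraMap_eq R (sectionRing f m) (FractionRing (sectionRing f m))]
  exact (IsFractionRing.injective (sectionRing f m) _).comp (algebraMap_sectionRing_injective f m)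

theorem inv_pow_mul_mem_adjoin {B : Type*} [Field B] [Algebra R B] (c e : R) (n : ℕ) :
    (algebraMap R B c)⁻¹ ^ n * algebraMap R B e ∈ Algebra.adjoin R {(algebraMap R B c)⁻¹} :=
  mul_mem (pow_mem (Algebra.subset_adjoin (by simp)) n) (Subalgebra.algebraMap_mem _ _)

theorem sectionGen_relation {f : FractionRing R} {a b : R} {m i j d : ℕ} (hi : i ≤ m) (hj : j ≤ m)
    (hd : i + d = j) (h : f * algebraMap R _ b = algebraMap R _ a) :
    algebraMap R _ b ^ d * sectionGen f hj = algebraMap R _ a ^ d * sectionGen f hi := by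
  subst hd
  simp only [sectionGen, IsScalarTower.algebraMap_apply R (sectionRing f m)
    (FractionRing (sectionRing f m)), ← map_pow, ← map_mul]
  congr 1
  ext1
  change algebraMap R (FractionRing R)[X] (b ^ d) * (C (f ^ (i + d)) * X) =
    algebraMap R (FractionRing R)[X] (a ^ d) * (C (f ^ i) * X)
  rw [Polynomial.algebraMap_apply, Polynomial.algebraMap_apply, map_pow,
    map_pow (algebraMap _ _) a, ← h,
    ← mul_assoc, ← mul_assoc, ← C_mul, ← C_mul]
  ring_nf

/-- Regular functions `a, b, a', b'` with `f = a / b = a' / b'` and `b + a' = 1`, so that `f` is a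
morphism to `ℙ¹`: it is regular where `b ≠ 0`, and `1 / f` is regular where `a' ≠ 0`. -/
structure P1Cover (f : FractionRing R) where
  a : R
  b : R
  a' : R
  b' : R
  b_ne : b ≠ 0
  a'_ne : a' ≠ 0
  rel : f * algebraMap R _ b = algebraMap R _ a
  rel' : f * algebraMap R _ b' = algebraMap R _ a'
  cover : b + a' = 1

namespace P1Cover

variable {f : FractionRing R} (c : P1Cover f)

theorem f_ne_zero (c : P1Cover f) : f ≠ 0 := by
  rintro rfl
  have h := c.rel'
  rw [zero_mul] at h
  exact c.a'_ne ((map_eq_zero_iff _ (IsFractionRing.injective R (FractionRing R))).mp h.symm)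

theorem b'_ne : c.b' ≠ 0 := by
  intro h0
  have h := c.rel'
  rw [h0, map_zero, mul_zero] at h
  exact c.a'_ne ((map_eq_zero_iff _ (IsFractionRing.injective R (FractionRing R))).mp h.symm)

theorem a_mul_b' : c.a * c.b' = c.a' * c.b := by
  apply IsFractionRing.injective R (FractionRing R)
  rw [map_mul, map_mul, ← c.rel, ← c.rel']
  ring

end P1Cover

variable [IsDomain R]

theorem transcendental_sectionGen {f : FractionRing R} (hf : f ≠ 0) {m i : ℕ} (hi : i ≤ m) :
    Transcendental R (sectionGen f hi) := by
  unfold sectionGen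
  rw [transcendental_algebraMap_iff
    (IsFractionRing.injective (sectionRing f m) (FractionRing (sectionRing f m)))]
  rw [← transcendental_algebraMap_iff (S := sectionRing f m) (A := (FractionRing R)[X])
    Subtype.val_injective]
  change Transcendental R (C (f ^ i) * X)
  intro h
  have h1 : IsAlgebraic (FractionRing R) (C (f ^ i) * X) := h.extendScalars
    (IsFractionRing.injective R (FractionRing R))
  have h2 : IsAlgebraic (FractionRing R) (C (f ^ i)⁻¹ * (C (f ^ i) * X) : (FractionRing R)[X]) :=
    (isAlgebraic_algebraMap (f ^ i)⁻¹).mul h1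
  rw [← mul_assoc, ← C_mul, inv_mul_cancel₀ (pow_ne_zero _ hf), C_1, one_mul] at h2
  exact Polynomial.transcendental_X (FractionRing R) h2

theorem sectionGen_ne_zero {f : FractionRing R} (hf : f ≠ 0) {m i : ℕ} (hi : i ≤ m) :
    sectionGen f hi ≠ 0 := by
  intro h
  apply transcendental_sectionGen hf hi
  rw [h]
  exact isAlgebraic_zero

/-- A chart is trivial once every generator `f ^ i X` is a multiple of a single one by a function
regular on that chart. -/
theorem adjoin_inv_sectionRing {f : FractionRing R} {m j : ℕ} (hj : j ≤ m) {c : R}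
    (h : ∀ i (hi : i ≤ m), ∃ x ∈ Algebra.adjoin R
      {(algebraMap R (FractionRing (sectionRing f m)) c)⁻¹}, sectionGen f hi = x * sectionGen f hj) :
    (Algebra.adjoin (sectionRing f m)
      {(algebraMap R (FractionRing (sectionRing f m)) c)⁻¹}).restrictScalars R =
      Algebra.adjoin R {(algebraMap R (FractionRing (sectionRing f m)) c)⁻¹, sectionGen f hj} := by
  apply le_antisymm
  · intro x hx
    have hx' : x ∈ Algebra.adjoin (sectionRing f m)
      {(algebraMap R (FractionRing (sectionRing f m)) c)⁻¹} := hx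
    clear hx
    induction hx' using Algebra.adjoin_induction with
    | mem x hx =>
      obtain rfl := hx
      exact Algebra.subset_adjoin (by simp)
    | add x y _ _ hx hy => exact add_mem hx hy
    | mul x y _ _ hx hy => exact mul_mem hx hy
    | algebraMap y =>
      obtain ⟨y, hy⟩ := y
      induction hy using Algebra.adjoin_induction with
      | mem y hy =>
        obtain ⟨i, hi, rfl⟩ := hy
        obtain ⟨x, hx, hxy⟩ := h i hi
        change sectionGen f hi ∈ _
        rw [hxy]
        exact mul_mem (Algebra.adjoin_mono (by simp) hx) (Algebra.subset_adjoin (by simp))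
      | add x y hx' hy' hx hy =>
        have : (⟨x + y, add_mem hx' hy'⟩ : sectionRing f m) = ⟨x, hx'⟩ + ⟨y, hy'⟩ := rfl
        rw [this, map_add]
        exact add_mem hx hy
      | mul x y hx' hy' hx hy =>
        have : (⟨x * y, mul_mem hx' hy'⟩ : sectionRing f m) = ⟨x, hx'⟩ * ⟨y, hy'⟩ := rfl
        rw [this, map_mul]
        exact mul_mem hx hy
      | algebraMap y =>
        change algebraMap (sectionRing f m) _ (algebraMap R (sectionRing f m) y) ∈ _
        rw [← IsScalarTower.algebraMap_apply]
        exact Subalgebra.algebraMap_mem _ _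
  · refine Algebra.adjoin_le ?_
    intro x hx
    rw [SetLike.mem_coe, Subalgebra.mem_restrictScalars]
    rcases hx with rfl | rfl
    · exact Algebra.subset_adjoin rfl
    · exact Subalgebra.algebraMap_mem (Algebra.adjoin (sectionRing f m) _) _

namespace P1Cover

variable {f : FractionRing R} (c : P1Cover f)

theorem a_ne : c.a ≠ 0 := by
  intro h0
  have h := c.rel
  rw [h0, map_zero] at h
  exact c.b_ne ((map_eq_zero_iff _ (IsFractionRing.injective R (FractionRing R))).mp
    ((mul_eq_zero.mp h).resolve_left c.f_ne_zero))

variable (m : ℕ)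

/-- On this chart `f ^ i X = (a / b) ^ i X`. -/
theorem trivial_fst :
    (Algebra.adjoin (sectionRing f m)
      {(algebraMap R (FractionRing (sectionRing f m)) c.b)⁻¹}).restrictScalars R =
      Algebra.adjoin R {(algebraMap R (FractionRing (sectionRing f m)) c.b)⁻¹,
        sectionGen f (Nat.zero_le m)} := by
  refine adjoin_inv_sectionRing _ fun i hi => ⟨_, inv_pow_mul_mem_adjoin c.b (c.a ^ i) i, ?_⟩
  have hb : algebraMap R (FractionRing (sectionRing f m)) c.b ≠ 0 := by
    rw [Ne, map_eq_zero_iff _ (algebraMap_fractionRing_sectionRing_injective f m)]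
    exact c.b_ne
  rw [map_pow, mul_assoc, ← sectionGen_relation (Nat.zero_le m) hi (zero_add i) c.rel, ← mul_assoc,
    ← mul_pow, inv_mul_cancel₀ hb, one_pow, one_mul]

/-- On this chart `f ^ i X = (b' / a') ^ (m - i) (f ^ m X)`. -/
theorem trivial_snd :
    (Algebra.adjoin (sectionRing f m)
      {(algebraMap R (FractionRing (sectionRing f m)) c.a')⁻¹}).restrictScalars R =
      Algebra.adjoin R {(algebraMap R (FractionRing (sectionRing f m)) c.a')⁻¹,
        sectionGen f (le_refl m)} := by
  refine adjoin_inv_sectionRing _ fun i hi =>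
    ⟨_, inv_pow_mul_mem_adjoin c.a' (c.b' ^ (m - i)) (m - i), ?_⟩
  have hb : algebraMap R (FractionRing (sectionRing f m)) c.a' ≠ 0 := by
    rw [Ne, map_eq_zero_iff _ (algebraMap_fractionRing_sectionRing_injective f m)]
    exact c.a'_ne
  rw [map_pow, mul_assoc, sectionGen_relation hi (le_refl m) (by omega) c.rel', ← mul_assoc,
    ← mul_pow, inv_mul_cancel₀ hb, one_pow, one_mul]

/-- The transition function `f ^ m` on the intersection of the two charts. -/
def transitionUnit {B : Type*} [Field B] [Algebra R B]
    (hB : Function.Injective (algebraMap R B)) {x : R} (hx : x = c.b * c.a') :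
    (Algebra.adjoin R {(algebraMap R B x)⁻¹})ˣ where
  -- Over the common denominator `b a'`, `f = a / b` becomes `a a' / (b a')`, and `1 / f = b' / a'`
  -- becomes `b b' / (b a')`.
  val := ⟨(algebraMap R B x)⁻¹ ^ m * algebraMap R B ((c.a * c.a') ^ m),
    inv_pow_mul_mem_adjoin _ _ _⟩
  inv := ⟨(algebraMap R B x)⁻¹ ^ m * algebraMap R B ((c.b * c.b') ^ m),
    inv_pow_mul_mem_adjoin _ _ _⟩
  val_inv := by
    have hx0 : algebraMap R B x ≠ 0 := by
      rw [Ne, map_eq_zero_iff _ hB, hx]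
      exact mul_ne_zero c.b_ne c.a'_ne
    ext1
    simp only [MulMemClass.mk_mul_mk, OneMemClass.coe_one]
    have h : (c.a * c.a') * (c.b * c.b') = x * x := by
      rw [hx]; linear_combination (c.a' * c.b) * c.a_mul_b'
    rw [mul_mul_mul_comm, ← map_mul, ← mul_pow, ← mul_pow, h, map_pow, map_mul, ← mul_pow]
    field_simp
    simp
  inv_val := by
    have hx0 : algebraMap R B x ≠ 0 := by
      rw [Ne, map_eq_zero_iff _ hB, hx]
      exact mul_ne_zero c.b_ne c.a'_ne
    ext1
    simp only [MulMemClass.mk_mul_mk, OneMemClass.coe_one]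
    have h : (c.b * c.b') * (c.a * c.a') = x * x := by
      rw [hx]; linear_combination (c.a' * c.b) * c.a_mul_b'
    rw [mul_mul_mul_comm, ← map_mul, ← mul_pow, ← mul_pow, h, map_pow, map_mul, ← mul_pow]
    field_simp
    simp

theorem transitionUnit_mul_sectionGen {x : R} (hx : x = c.b * c.a') :
    (c.transitionUnit m (algebraMap_fractionRing_sectionRing_injective f m) hx : Algebra.adjoin R
      {(algebraMap R (FractionRing (sectionRing f m)) x)⁻¹}).1 *
        sectionGen f (Nat.zero_le m) = sectionGen f (le_refl m) := by
  have hB := algebraMap_fractionRing_sectionRing_injective f m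
  have hx0 : algebraMap R (FractionRing (sectionRing f m)) x ≠ 0 := by
    rw [Ne, map_eq_zero_iff _ hB, hx]
    exact mul_ne_zero c.b_ne c.a'_ne
  change (algebraMap R (FractionRing (sectionRing f m)) x)⁻¹ ^ m *
    algebraMap R (FractionRing (sectionRing f m)) ((c.a * c.a') ^ m) * _ = _
  rw [mul_pow, map_mul, map_pow, map_pow, mul_assoc, mul_right_comm,
    ← sectionGen_relation (Nat.zero_le m) (le_refl m) (zero_add m) c.rel, mul_right_comm,
    ← mul_pow, ← map_mul, ← hx, ← mul_assoc, ← mul_pow, inv_mul_cancel₀ hx0, one_pow, one_mul]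

theorem transitionUnit_inv_mul_sectionGen {x : R} (hx : x = c.b * c.a') :
    sectionGen f (Nat.zero_le m) =
      ((c.transitionUnit m (algebraMap_fractionRing_sectionRing_injective f m) hx)⁻¹.1 :
        Algebra.adjoin R {(algebraMap R (FractionRing (sectionRing f m)) x)⁻¹}).1 *
        sectionGen f (le_refl m) := by
  rw [← c.transitionUnit_mul_sectionGen m hx, ← mul_assoc, ← MulMemClass.coe_mul, Units.inv_mul,
    OneMemClass.coe_one, one_mul]

/-- The line bundle whose regular functions are `R[X, f X, …, f ^ m X]`. -/
def bundle [Algebra ℂ R] : LineBundle R where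
  total := sectionRing f m
  injective := algebraMap_sectionRing_injective f m
  n := 2
  r := ![c.b, c.a']
  r_ne_zero i := by
    fin_cases i
    exacts [c.b_ne, c.a'_ne]
  cover := by
    rw [Ideal.eq_top_iff_one, ← c.cover]
    exact add_mem (Ideal.subset_span ⟨0, rfl⟩) (Ideal.subset_span ⟨1, rfl⟩)
  t := ![sectionGen f (Nat.zero_le m), sectionGen f (le_refl m)]
  t_transcendental i := by
    fin_cases i
    exacts [transcendental_sectionGen c.f_ne_zero (Nat.zero_le m),
      transcendental_sectionGen c.f_ne_zero (le_refl m)]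
  trivial i := by
    fin_cases i
    exacts [c.trivial_fst m, c.trivial_snd m]
  transition i j := by
    have hB := algebraMap_fractionRing_sectionRing_injective f m
    fin_cases i <;> fin_cases j
    · exact ⟨1, by simp⟩
    · exact ⟨(c.transitionUnit m hB rfl)⁻¹, c.transitionUnit_inv_mul_sectionGen m rfl⟩
    · exact ⟨c.transitionUnit m hB (mul_comm _ _),
        (c.transitionUnit_mul_sectionGen m (mul_comm _ _)).symm⟩
    · exact ⟨1, by simp⟩

end P1Cover

end Bundle

end

/-! ### Orders of vanishing -/

section Orders

variable {R : Type} [CommRing R]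

/-- The order of vanishing of a regular function along a prime divisor. -/
noncomputable def ordNat (p : PrimeSpectrum R) (x : R) : ℕ :=
  (Ring.ord (Localization.AtPrime p.asIdeal) (algebraMap R _ x)).toNat

theorem ordNat_of_notMem {p : PrimeSpectrum R} {x : R} (hx : x ∉ p.asIdeal) : ordNat p x = 0 := by
  have : IsUnit (algebraMap R (Localization.AtPrime p.asIdeal) x) :=
    IsLocalization.map_units (Localization.AtPrime p.asIdeal)
      (⟨x, hx⟩ : p.asIdeal.primeCompl)
  rw [ordNat, Ring.ord_of_isUnit this]
  rfl

variable [IsDomain R] [IsNoetherianRing R] {p : PrimeSpectrum R} (hp : p.asIdeal.height = 1)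

include hp

/-- The localization at `p` is Noetherian of dimension at most one, so the orders are finite and
`toNat` loses nothing. -/
theorem ordNat_mul {x y : R} (hx : x ≠ 0) (hy : y ≠ 0) :
    ordNat p (x * y) = ordNat p x + ordNat p y := by
  have hdim : Ring.KrullDimLE 1 (Localization.AtPrime p.asIdeal) := by
    rw [Ring.krullDimLE_iff, IsLocalization.AtPrime.ringKrullDim_eq_height p.asIdeal, hp]
    rfl
  have hinj : Function.Injective (algebraMap R (Localization.AtPrime p.asIdeal)) :=
    IsLocalization.injective _ p.asIdeal.primeCompl_le_nonZeroDivisors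
  have h : ∀ {z : R}, z ≠ 0 →
      algebraMap R (Localization.AtPrime p.asIdeal) z ∈ nonZeroDivisors _ := fun hz =>
    mem_nonZeroDivisors_of_ne_zero (by rwa [Ne, map_eq_zero_iff _ hinj])
  rw [ordNat, map_mul, Ring.ord_mul _ (h hy), ENat.toNat_add (Ring.ord_ne_top (h hx))
    (Ring.ord_ne_top (h hy)), ordNat, ordNat]

theorem ordNat_pow {x : R} (hx : x ≠ 0) (m : ℕ) : ordNat p (x ^ m) = m * ordNat p x := by
  induction m with
  | zero => simp [ordNat]
  | succ m ih => rw [pow_succ, ordNat_mul hp (pow_ne_zero _ hx) hx, ih]; ring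

/-- Frees `ordAt` from the chosen representative: two fractions for `h` are compared by
cross-multiplication and additivity. -/
theorem ordAt_eq_sub {h : FractionRing R} {x y : R} (hx : x ≠ 0) (hy : y ≠ 0)
    (hxy : h * algebraMap R _ y = algebraMap R _ x) :
    ordAt p h = (ordNat p x : ℤ) - ordNat p y := by
  have hinj := IsFractionRing.injective R (FractionRing R)
  have hs := IsLocalization.sec_spec (nonZeroDivisors R) h
  change (ordNat p (IsLocalization.sec (nonZeroDivisors R) h).1 : ℤ) -
    ordNat p (IsLocalization.sec (nonZeroDivisors R) h).2 = _
  set s := IsLocalization.sec (nonZeroDivisors R) h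
  have h2 : (s.2 : R) ≠ 0 := nonZeroDivisors.ne_zero s.2.2
  have key : s.1 * y = x * s.2 := by
    apply hinj
    rw [map_mul, map_mul, ← hs, ← hxy]
    ring
  have h1 : s.1 ≠ 0 := fun h0 => by
    rw [h0, zero_mul] at key
    exact mul_ne_zero hx h2 key.symm
  have := congrArg (ordNat p) key
  rw [ordNat_mul hp h1 hy, ordNat_mul hp hx h2] at this
  omega

end Orders

/-! ### Pullback to the bundle and its divisor -/

section Pullback

variable {R : Type} [CommRing R] [IsDomain R]

/-- The pullback of rational functions to the line bundle. -/
noncomputable def sectionPullback (f : FractionRing R) (m : ℕ) :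
    FractionRing R →+* FractionRing (sectionRing f m) :=
  IsFractionRing.lift (algebraMap_fractionRing_sectionRing_injective f m)

theorem sectionPullback_algebraMap (f : FractionRing R) (m : ℕ) (x : R) :
    sectionPullback f m (algebraMap R _ x) = algebraMap R _ x :=
  IsFractionRing.lift_algebraMap _ _

theorem sectionPullback_mul_algebraMap {f : FractionRing R} {m : ℕ} {x : FractionRing R} {a b : R}
    (h : x * algebraMap R _ b = algebraMap R _ a) :
    sectionPullback f m x * algebraMap R _ b = algebraMap R _ a := by
  rw [← sectionPullback_algebraMap f m a, ← h, map_mul, sectionPullback_algebraMap]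

end Pullback

namespace P1Cover

variable {R : Type} [CommRing R] [IsDomain R] {f : FractionRing R} (c : P1Cover f) (m : ℕ)

theorem sectionPullback_pow_mul_sectionGen (c : P1Cover f) (m : ℕ) :
    sectionPullback f m (f ^ m) * sectionGen f (Nat.zero_le m) = sectionGen f (le_refl m) := by
  have hb : algebraMap R (FractionRing (sectionRing f m)) c.b ≠ 0 := by
    rw [Ne, map_eq_zero_iff _ (algebraMap_fractionRing_sectionRing_injective f m)]
    exact c.b_ne
  have h2 := sectionGen_relation (Nat.zero_le m) (le_refl m) (zero_add m) c.rel
  rw [← sectionPullback_mul_algebraMap c.rel] at h2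
  apply mul_left_cancel₀ (pow_ne_zero m hb)
  rw [h2, map_pow]
  ring

/-- The local equations are `1` and `f ^ m`. Where `b ≠ 0` there is no pole; where `a' ≠ 0` there is
no zero, so the order of `f` is minus its pole order. -/
theorem isAssociated [Algebra ℂ R] [IsNoetherianRing R] :
    (c.bundle m).IsAssociated (fun p => -(m : ℤ) * polarDivisor f p) := by
  have ht : ∀ i : Fin 2, ![sectionGen f (Nat.zero_le m), sectionGen f (le_refl m)] i =
      sectionPullback f m (![1, f ^ m] i) * sectionGen f (Nat.zero_le m) := by
    intro i
    fin_cases i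
    · change _ = sectionPullback f m 1 * _
      rw [map_one, one_mul]
      rfl
    · exact (c.sectionPullback_pow_mul_sectionGen m).symm
  refine ⟨(![1, f ^ m] : Fin 2 → _), fun (i : Fin 2) => ?_, fun (i j : Fin 2) => ?_,
    fun (i : Fin 2) p hp hi => ?_⟩
  · fin_cases i
    exacts [one_ne_zero, pow_ne_zero _ c.f_ne_zero]
  · change ![sectionGen f (Nat.zero_le m), sectionGen f (le_refl m)] i /
      ![sectionGen f (Nat.zero_le m), sectionGen f (le_refl m)] j =
      sectionPullback f m (![1, f ^ m] i / ![1, f ^ m] j)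
    rw [ht, ht, map_div₀]
    exact mul_div_mul_right _ _ (sectionGen_ne_zero c.f_ne_zero _)
  · fin_cases i
    · replace hi : c.b ∉ p.asIdeal := hi
      change ordAt p 1 = -(m : ℤ) * max 0 (-ordAt p f)
      rw [ordAt_eq_sub hp one_ne_zero one_ne_zero (one_mul _),
        ordAt_eq_sub hp c.a_ne c.b_ne c.rel, ordNat_of_notMem hi, max_eq_left (by simp)]
      simp
    · replace hi : c.a' ∉ p.asIdeal := hi
      change ordAt p (f ^ m) = -(m : ℤ) * max 0 (-ordAt p f)
      rw [ordAt_eq_sub hp (pow_ne_zero m c.a'_ne) (pow_ne_zero m c.b'_ne)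
          (by rw [map_pow, map_pow, ← mul_pow, c.rel']),
        ordAt_eq_sub hp c.a'_ne c.b'_ne c.rel', ordNat_pow hp c.a'_ne, ordNat_pow hp c.b'_ne,
        ordNat_of_notMem hi, max_eq_right (by simp)]
      simp

end P1Cover

/-- A morphism to `ℙ¹` is given by two quotients of regular functions. -/
theorem IsMorphismToP1.nonempty_cover {R : Type} [CommRing R] [IsDomain R] [CharZero R]
    {f : FractionRing R} (hf : IsMorphismToP1 f) (hf0 : f ≠ 0) : Nonempty (P1Cover f) := by
  have hinj := IsFractionRing.injective R (FractionRing R)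
  -- The sum of the ideal of denominators of `f` and the ideal of its numerators; being a morphism
  -- says that no maximal ideal contains it.
  let I : Ideal R :=
    { carrier := {b | ∃ a b' a', f * algebraMap R _ a' = algebraMap R _ a ∧ b = b' + a ∧
        ∃ a'', f * algebraMap R _ b' = algebraMap R _ a''}
      zero_mem' := ⟨0, 0, 0, by simp, by simp, 0, by simp⟩
      add_mem' := by
        rintro x y ⟨a, b, c, h1, h2, d, h3⟩ ⟨a', b', c', h1', h2', d', h3'⟩
        refine ⟨a + a', b + b', c + c', ?_, ?_, d + d', ?_⟩
        · rw [map_add, map_add, mul_add, h1, h1']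
        · rw [h2, h2']; ring
        · rw [map_add, map_add, mul_add, h3, h3']
      smul_mem' := by
        rintro r x ⟨a, b, c, h1, h2, d, h3⟩
        refine ⟨r * a, r * b, r * c, ?_, ?_, r * d, ?_⟩
        · rw [map_mul, map_mul, ← h1]; ring
        · rw [h2, smul_eq_mul]; ring
        · rw [map_mul, map_mul, ← h3]; ring }
  have hI : I = ⊤ := by
    by_contra hne
    obtain ⟨M, hM, hIM⟩ := Ideal.exists_le_maximal I hne
    obtain ⟨a, b, hab, h⟩ := hf ⟨M, hM.isPrime⟩
    rcases hab with ha | hb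
    · exact ha (hIM ⟨a, 0, b, h, by simp, 0, by simp⟩)
    · exact hb (hIM ⟨0, b, 0, by simp, by simp, a, h⟩)
  obtain ⟨a', b, b', h1, h2, a, h3⟩ : (1 : R) ∈ I := hI ▸ Submodule.mem_top
  -- Both charts must be nonempty. If `b` or `a'` vanishes, then `1 / f` or `f` is regular, and `1`
  -- is split again as `e z + (1 - e z)` with both parts nonzero.
  have hex : ∀ z : R, ∃ e : R, e ≠ 0 ∧ e * z ≠ 1 := by
    intro z
    by_cases hz : z = 1
    · exact ⟨2, two_ne_zero, by rw [hz]; norm_num⟩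
    · exact ⟨1, one_ne_zero, by rwa [one_mul]⟩
  by_cases hb : b = 0
  · obtain rfl : a' = 1 := by rw [h2, hb, zero_add]
    have hb' : b' ≠ 0 := by
      rintro rfl
      simp at h1
    obtain ⟨e, he, hez⟩ := hex b'
    refine ⟨⟨e, e * b', 1 - e * b', b' * (1 - e * b'), mul_ne_zero he hb',
      sub_ne_zero.mpr hez.symm, ?_, ?_, by ring⟩⟩
    · rw [map_mul, mul_left_comm, h1, map_one, mul_one]
    · rw [map_mul, ← mul_assoc, h1, map_one, one_mul]
  by_cases ha' : a' = 0
  · obtain rfl : b = 1 := by rw [h2, ha', add_zero]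
    rw [map_one, mul_one] at h3
    have ha : a ≠ 0 := by
      rintro rfl
      exact hf0 (by rw [h3, map_zero])
    obtain ⟨e, he, hez⟩ := hex a
    refine ⟨⟨a * (1 - e * a), 1 - e * a, e * a, e, sub_ne_zero.mpr hez.symm,
      mul_ne_zero he ha, ?_, ?_, by ring⟩⟩
    · rw [map_mul, h3]
    · rw [map_mul, h3, mul_comm]
  · exact ⟨⟨a, b, a', b', hb, ha', h3, h1, h2.symm⟩⟩

/-! ### Derivations -/

/-- Localization is formally étale, so the differentials of the fraction field are the base change
of those of `B`. -/
theorem exists_derivation_fractionRing {B : Type*} [CommRing B] [IsDomain B] [Algebra ℂ B]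
    (D : Derivation ℂ B B) : ∃ E : Derivation ℂ (FractionRing B) (FractionRing B),
      ∀ b : B, E (algebraMap B (FractionRing B) b) = algebraMap B (FractionRing B) (D b) := by
  have : Algebra.FormallyEtale B (FractionRing B) :=
    Algebra.FormallyEtale.of_isLocalization (nonZeroDivisors B)
  let l : FractionRing B ⊗[B] Ω[B⁄ℂ] →ₗ[FractionRing B] FractionRing B :=
    ((Algebra.linearMap B (FractionRing B)).comp D.liftKaehlerDifferential).liftBaseChange _
  let e := KaehlerDifferential.tensorKaehlerEquivOfFormallyEtale ℂ B (FractionRing B)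
  refine ⟨(l.comp e.symm.toLinearMap).compDer (KaehlerDifferential.D ℂ (FractionRing B)),
    fun b => ?_⟩
  change l (e.symm (KaehlerDifferential.D ℂ (FractionRing B) (algebraMap B _ b))) = _
  rw [KaehlerDifferential.tensorKaehlerEquivOfFormallyEtale_symm_D_algebraMap]
  simp [l]

theorem iterate_mul_eq_zero {B : Type*} [CommRing B] [Algebra ℂ B] (D : Derivation ℂ B B)
    {s : ℕ} : ∀ {a b : B} {n m : ℕ}, n + m = s → D^[n] a = 0 → D^[m] b = 0 →
      D^[s] (a * b) = 0 := by
  induction s with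
  | zero =>
    intro a b n m h ha hb
    obtain ⟨rfl, rfl⟩ := Nat.add_eq_zero_iff.mp h
    simp_all
  | succ s ih =>
    intro a b n m h ha hb
    have h0 : ∀ t, D^[t] 0 = 0 := fun t => iterate_map_zero D t
    rcases n with _ | n
    · obtain rfl : a = 0 := ha
      rw [zero_mul, h0]
    rcases m with _ | m
    · obtain rfl : b = 0 := hb
      rw [mul_zero, h0]
    rw [Function.iterate_succ_apply, D.leibniz, smul_eq_mul, smul_eq_mul, iterate_map_add,
      ih (n := n + 1) (m := m) (by omega) ha hb, ih (n := m + 1) (m := n) (by omega) hb ha,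
      add_zero]

theorem iterate_eq_zero_of_le {B : Type*} [CommRing B] [Algebra ℂ B] (D : Derivation ℂ B B)
    {a : B} {n m : ℕ} (h : n ≤ m) (ha : D^[n] a = 0) : D^[m] a = 0 := by
  obtain ⟨d, rfl⟩ := Nat.exists_eq_add_of_le h
  rw [add_comm, Function.iterate_add_apply, ha, iterate_map_zero]

/-- The derivation of `B[X]` that applies a derivation of `B` to the coefficients. -/
noncomputable def coeffDerivation {B : Type*} [CommRing B] [Algebra ℂ B] (D : Derivation ℂ B B) :
    Derivation ℂ B[X] B[X] :=
  PolynomialModule.equivPolynomialSelf.compDer D.mapCoeffs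

theorem coeffDerivation_C {B : Type*} [CommRing B] [Algebra ℂ B] (D : Derivation ℂ B B) (x : B) :
    coeffDerivation D (C x) = C (D x) := by
  ext i
  change (D.mapCoeffs (C x)).coeff i = _
  rw [Derivation.mapCoeffs_apply, coeff_C, coeff_C]
  split_ifs <;> simp

theorem coeffDerivation_X {B : Type*} [CommRing B] [Algebra ℂ B] (D : Derivation ℂ B B) :
    coeffDerivation D X = 0 := by
  change PolynomialModule.equivPolynomialSelf (D.mapCoeffs X) = 0
  rw [Derivation.mapCoeffs_X, map_zero]

theorem coeffDerivation_X_pow {B : Type*} [CommRing B] [Algebra ℂ B] (D : Derivation ℂ B B)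
    (n : ℕ) : coeffDerivation D (X ^ n) = 0 := by
  rw [Derivation.leibniz_pow, coeffDerivation_X, smul_zero, smul_zero]

/-! ### Derivations of the coordinate ring of the bundle -/

section SectionRing

variable {R : Type} [CommRing R] [Algebra ℂ R] {f : FractionRing R} {m : ℕ}
  {Δ : Derivation ℂ (FractionRing R)[X] (FractionRing R)[X]}

theorem derivation_mem_sectionRing
    (hR : ∀ r : R, Δ (C (algebraMap R _ r)) ∈ sectionRing f m)
    (hX : ∀ i ≤ m, Δ (C (f ^ i) * X) ∈ sectionRing f m) {p : (FractionRing R)[X]}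
    (hp : p ∈ sectionRing f m) : Δ p ∈ sectionRing f m := by
  induction hp using Algebra.adjoin_induction with
  | mem p hp => obtain ⟨i, hi, rfl⟩ := hp; exact hX i hi
  | algebraMap r => exact hR r
  | add p q _ _ hp hq => rw [map_add]; exact add_mem hp hq
  | mul p q hp' hq' hp hq =>
    rw [Δ.leibniz]
    exact add_mem (mul_mem hp' hq) (mul_mem hq' hp)

/-- Elements killed by some iterate are closed under sums and products, so generators suffice. -/
theorem exists_iterate_eq_zero_of_mem_sectionRing
    (hR : ∀ r : R, ∃ n : ℕ, Δ^[n] (C (algebraMap R _ r)) = 0)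
    (hX : ∀ i ≤ m, ∃ n : ℕ, Δ^[n] (C (f ^ i) * X) = 0) {p : (FractionRing R)[X]}
    (hp : p ∈ sectionRing f m) : ∃ n : ℕ, Δ^[n] p = 0 := by
  induction hp using Algebra.adjoin_induction with
  | mem p hp => obtain ⟨i, hi, rfl⟩ := hp; exact hX i hi
  | algebraMap r => exact hR r
  | add p q _ _ hp hq =>
    obtain ⟨n, hn⟩ := hp
    obtain ⟨k, hk⟩ := hq
    refine ⟨max n k, ?_⟩
    rw [iterate_map_add, iterate_eq_zero_of_le Δ (le_max_left n k) hn,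
      iterate_eq_zero_of_le Δ (le_max_right n k) hk, add_zero]
  | mul p q _ _ hp hq =>
    obtain ⟨n, hn⟩ := hp
    obtain ⟨k, hk⟩ := hq
    exact ⟨n + k, iterate_mul_eq_zero Δ rfl hn hk⟩

/-- The restriction of a derivation to the ring of regular functions of the line bundle. -/
noncomputable def restrictDerivation (h : ∀ p ∈ sectionRing f m, Δ p ∈ sectionRing f m) :
    Derivation ℂ (sectionRing f m) (sectionRing f m) where
  toFun p := ⟨Δ p, h p p.2⟩
  map_add' p q := Subtype.ext (Δ.map_add p q)
  map_smul' c p := Subtype.ext (Δ.map_smul c p)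
  map_one_eq_zero' := Subtype.ext Δ.map_one_eq_zero
  leibniz' p q := Subtype.ext (Δ.leibniz p q)

theorem restrictDerivation_isLocallyNilpotent
    (h : ∀ p ∈ sectionRing f m, Δ p ∈ sectionRing f m)
    (hn : ∀ p ∈ sectionRing f m, ∃ n : ℕ, Δ^[n] p = 0) :
    IsLocallyNilpotent (B := sectionRing f m) (restrictDerivation h) := by
  intro p
  obtain ⟨n, hn⟩ := hn p p.2
  refine ⟨n, Subtype.ext ?_⟩
  have : Function.Semiconj (Subtype.val : sectionRing f m → _) (restrictDerivation h) Δ :=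
    fun _ => rfl
  rw [(this.iterate_right n).eq, hn]
  rfl

variable [IsDomain R]

/-- For `x = a / b`, `Δ (C x) = 0` amounts to `b Δ a = a Δ b`, an identity between regular
functions; the quotient rule then gives `b ^ 2 E y = 0` on the bundle. -/
theorem killsFraction_restrictDerivation
    (h : ∀ p ∈ sectionRing f m, Δ p ∈ sectionRing f m) {x : FractionRing R} (hx : Δ (C x) = 0) :
    KillsFraction (B := sectionRing f m) (restrictDerivation h) (sectionPullback f m x) := by
  obtain ⟨E, hE⟩ := exists_derivation_fractionRing (B := sectionRing f m) (restrictDerivation h)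
  refine ⟨E, hE, ?_⟩
  obtain ⟨a, b, hb, rfl⟩ := IsFractionRing.div_surjective (A := R) x
  set x := algebraMap R (FractionRing R) a / algebraMap R (FractionRing R) b with hx_def
  have hinj := algebraMap_fractionRing_sectionRing_injective f m
  have hb0 : b ≠ 0 := nonZeroDivisors.ne_zero hb
  have hbF : algebraMap R (FractionRing R) b ≠ 0 := by
    rwa [Ne, map_eq_zero_iff _ (IsFractionRing.injective _ _)]
  have hbL : algebraMap R (FractionRing (sectionRing f m)) b ≠ 0 := by
    rwa [Ne, map_eq_zero_iff _ hinj]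
  have hxb : x * algebraMap R (FractionRing R) b = algebraMap R (FractionRing R) a :=
    div_mul_cancel₀ _ hbF
  have hΔ : C (algebraMap R (FractionRing R) b) * Δ (C (algebraMap R (FractionRing R) a)) =
      C (algebraMap R (FractionRing R) a) * Δ (C (algebraMap R (FractionRing R) b)) := by
    rw [← hxb, C_mul, Δ.leibniz, hx, smul_zero, add_zero, smul_eq_mul]
    ring
  have hD : algebraMap R (sectionRing f m) b *
      restrictDerivation h (algebraMap R (sectionRing f m) a) = algebraMap R (sectionRing f m) a *
      restrictDerivation h (algebraMap R (sectionRing f m) b) := Subtype.ext hΔ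
  have hEab := congrArg (algebraMap (sectionRing f m) (FractionRing (sectionRing f m))) hD
  rw [map_mul, map_mul, ← hE, ← hE] at hEab
  simp only [← IsScalarTower.algebraMap_apply] at hEab
  have hpb := sectionPullback_mul_algebraMap (f := f) (m := m) hxb
  set y := sectionPullback f m x
  have hEy : E (y * algebraMap R (FractionRing (sectionRing f m)) b) =
    E (algebraMap R (FractionRing (sectionRing f m)) a) := congrArg E hpb
  rw [E.leibniz, smul_eq_mul, smul_eq_mul] at hEy
  have h0 : algebraMap R (FractionRing (sectionRing f m)) b ^ 2 * E y = 0 := by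
    linear_combination algebraMap R (FractionRing (sectionRing f m)) b * hEy + hEab
      - E (algebraMap R (FractionRing (sectionRing f m)) b) * hpb
  exact (mul_eq_zero.mp h0).resolve_left (pow_ne_zero 2 hbL)

end SectionRing

/-! ### Clearing denominators by constants of `D` -/

section Denominators

variable {R : Type} [CommRing R] {f : FractionRing R}

theorem exists_pow_mul_mem_adjoin {f₀ v w : FractionRing R} (hv : v ∈ Algebra.adjoin R {f})
    (hw : w ∈ Algebra.adjoin R {f}) (hf₀ : w * f₀ = v) {y : FractionRing R}
    (hy : y ∈ Algebra.adjoin R {f₀}) : ∃ N : ℕ, w ^ N * y ∈ Algebra.adjoin R {f} := by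
  induction hy using Algebra.adjoin_induction with
  | mem y hy =>
    obtain rfl := hy
    exact ⟨1, by rwa [pow_one, hf₀]⟩
  | algebraMap r => exact ⟨0, by rw [pow_zero, one_mul]; exact Subalgebra.algebraMap_mem _ r⟩
  | add y z _ _ hy hz =>
    obtain ⟨n, hn⟩ := hy
    obtain ⟨k, hk⟩ := hz
    refine ⟨n + k, ?_⟩
    rw [show w ^ (n + k) * (y + z) = w ^ k * (w ^ n * y) + w ^ n * (w ^ k * z) by ring]
    exact add_mem (mul_mem (pow_mem hw _) hn) (mul_mem (pow_mem hw _) hk)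
  | mul y z _ _ hy hz =>
    obtain ⟨n, hn⟩ := hy
    obtain ⟨k, hk⟩ := hz
    refine ⟨n + k, ?_⟩
    rw [show w ^ (n + k) * (y * z) = (w ^ n * y) * (w ^ k * z) by ring]
    exact mul_mem hn hk

/-- A polynomial in `f` of degree at most `k` times `X` is a combination of the generators. Allowing
all large `k` lets bounds be combined by maxima. -/
theorem exists_C_mul_X_mem_sectionRing {y : FractionRing R} (hy : y ∈ Algebra.adjoin R {f}) :
    ∃ m : ℕ, ∀ k, m ≤ k → C y * X ∈ sectionRing f k := by
  rw [Algebra.adjoin_singleton_eq_range_aeval] at hy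
  obtain ⟨p, rfl⟩ := hy
  change ∃ m : ℕ, ∀ k, m ≤ k → C (aeval f p) * X ∈ sectionRing f k
  induction p using Polynomial.induction_on' with
  | add p q hp hq =>
    obtain ⟨n, hn⟩ := hp
    obtain ⟨l, hl⟩ := hq
    refine ⟨max n l, fun k hk => ?_⟩
    rw [map_add, C_add, add_mul]
    exact add_mem (hn k (by omega)) (hl k (by omega))
  | monomial n r =>
    refine ⟨n, fun k hk => ?_⟩
    rw [aeval_monomial, C_mul, mul_assoc, ← Polynomial.algebraMap_apply]
    exact mul_mem (Subalgebra.algebraMap_mem _ r) (C_pow_mul_X_mem_sectionRing f hk)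

theorem aeval_mem_adjoin [Algebra ℂ R] (p : ℂ[X]) : aeval f p ∈ Algebra.adjoin R {f} := by
  have h : Algebra.adjoin ℂ {f} ≤ (Algebra.adjoin R {f}).restrictScalars ℂ :=
    Algebra.adjoin_le (Algebra.subset_adjoin (R := R))
  exact h (aeval_mem_adjoin_singleton ℂ f)

theorem exists_clearing_denominators [IsDomain R] [Algebra ℂ R] [Algebra.FiniteType ℂ R]
    {D : Derivation ℂ (FractionRing R) (FractionRing R)} {f₀ : FractionRing R}
    (hf : D f = 0) (hf₀ : f₀ ∈ IntermediateField.adjoin ℂ {f})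
    (hD : ∀ r : R, D (algebraMap R _ r) ∈ Algebra.adjoin R {f₀}) :
    ∃ (q : FractionRing R) (m : ℕ), q ≠ 0 ∧ D q = 0 ∧ 1 ≤ m ∧
      ∀ r : R, C (q * D (algebraMap R _ r)) * X ∈ sectionRing f m := by
  obtain ⟨v, w, hw0, hvw⟩ : ∃ v w : ℂ[X], aeval f w ≠ 0 ∧ aeval f w * f₀ = aeval f v := by
    obtain ⟨v, w, rfl⟩ := (IntermediateField.mem_adjoin_simple_iff ℂ f₀).mp hf₀
    -- Division by zero makes `f₀ = 0` here, rewritten as `0 / 1`.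
    by_cases hw : aeval f w = 0
    · exact ⟨0, 1, by simp, by simp [hw]⟩
    · exact ⟨v, w, hw, mul_div_cancel₀ _ hw⟩
  set W := aeval f w
  have hW : W ∈ Algebra.adjoin R {f} := aeval_mem_adjoin w
  have hDW : D W = 0 := by rw [D.map_aeval, hf, smul_zero]
  obtain ⟨s, hs⟩ := Algebra.FiniteType.out (R := ℂ) (A := R)
  choose N hN using fun r : R => exists_pow_mul_mem_adjoin (aeval_mem_adjoin v) hW hvw (hD r)
  set n := s.sup N
  have hn : ∀ r ∈ s, W ^ n * D (algebraMap R _ r) ∈ Algebra.adjoin R {f} := by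
    intro r hr
    have hle : N r ≤ n := Finset.le_sup hr
    rw [← Nat.sub_add_cancel hle, pow_add, mul_assoc]
    exact mul_mem (pow_mem hW _) (hN r)
  choose M hM using fun r : s => exists_C_mul_X_mem_sectionRing (hn r r.2)
  -- Both exponents are maxima over a finite generating set; the extra `1` secures `1 ≤ m`. Leibniz
  -- carries the bound to all of `R`.
  refine ⟨W ^ n, (Finset.univ.sup M) + 1, pow_ne_zero _ hw0, ?_, Nat.le_add_left _ _, fun r => ?_⟩
  · exact pow_mem (mem_constants.mpr hDW) n
  have hr : r ∈ Algebra.adjoin ℂ (s : Set R) := hs ▸ Algebra.mem_top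
  induction hr using Algebra.adjoin_induction with
  | mem r hr =>
    exact hM ⟨r, hr⟩ _ ((Finset.le_sup (Finset.mem_univ _)).trans (Nat.le_succ _))
  | algebraMap c =>
    rw [← IsScalarTower.algebraMap_apply, D.map_algebraMap, mul_zero, C_0, zero_mul]
    exact zero_mem _
  | add x y _ _ hx hy =>
    rw [map_add, map_add, mul_add, C_add, add_mul]
    exact add_mem hx hy
  | mul x y _ _ hx hy =>
    have key : C (W ^ n * D (algebraMap R _ (x * y))) * X =
        algebraMap R (FractionRing R)[X] x * (C (W ^ n * D (algebraMap R _ y)) * X) +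
        algebraMap R (FractionRing R)[X] y * (C (W ^ n * D (algebraMap R _ x)) * X) := by
      rw [map_mul (algebraMap R (FractionRing R)), D.leibniz, smul_eq_mul, smul_eq_mul,
        Polynomial.algebraMap_apply, Polynomial.algebraMap_apply]
      simp only [C_mul, C_add]
      ring
    rw [key]
    exact add_mem (mul_mem (Subalgebra.algebraMap_mem _ x) hy)
      (mul_mem (Subalgebra.algebraMap_mem _ y) hx)

end Denominators

/-! ### The two bundles and the theorem -/

section Main

variable {R : Type} [CommRing R] [IsDomain R] [Algebra ℂ R]

/-- The cover for the constant morphism `1`. -/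
noncomputable def P1Cover.one (R : Type) [CommRing R] [IsDomain R] [Algebra ℂ R] :
    P1Cover (1 : FractionRing R) where
  -- Halves make `b + a' = 1` with both terms nonzero.
  a := algebraMap ℂ R 2⁻¹
  b := algebraMap ℂ R 2⁻¹
  a' := algebraMap ℂ R 2⁻¹
  b' := algebraMap ℂ R 2⁻¹
  b_ne := by simp
  a'_ne := by simp
  rel := one_mul _
  rel' := one_mul _
  cover := by rw [← map_add]; norm_num

/-- The derivative along the fibres of the trivial line bundle. -/
theorem exists_lineBundle_kills_pullback (R : Type) [CommRing R] [IsDomain R] [Algebra ℂ R] :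
    ∃ (L : LineBundle R) (D' : Derivation ℂ L.total L.total),
      IsLocallyNilpotent D' ∧ D' ≠ 0 ∧ ∀ h, KillsFraction D' (L.pullback h) := by
  let Δ : Derivation ℂ (FractionRing R)[X] (FractionRing R)[X] :=
    (derivative' (R := FractionRing R)).restrictScalars ℂ
  have hΔC : ∀ x, Δ (C x) = 0 := fun x => derivative_C
  have hΔX : ∀ i ≤ 0, Δ (C ((1 : FractionRing R) ^ i) * X) = 1 := by
    intro i hi
    change derivative (C ((1 : FractionRing R) ^ i) * X) = 1
    simp
  have h : ∀ p ∈ sectionRing (1 : FractionRing R) 0, Δ p ∈ sectionRing (1 : FractionRing R) 0 :=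
    fun p hp => derivation_mem_sectionRing (fun r => by rw [hΔC]; exact zero_mem _)
      (fun i hi => by rw [hΔX i hi]; exact one_mem _) hp
  refine ⟨(P1Cover.one R).bundle 0, restrictDerivation h, ?_, fun h0 => ?_, fun x => ?_⟩
  · refine restrictDerivation_isLocallyNilpotent h fun p hp =>
      exists_iterate_eq_zero_of_mem_sectionRing (fun r => ⟨1, hΔC _⟩) (fun i hi => ⟨2, ?_⟩) hp
    change Δ (Δ _) = 0
    rw [hΔX i hi, Δ.map_one_eq_zero]
  · have h1 : restrictDerivation h ⟨_, C_pow_mul_X_mem_sectionRing 1 le_rfl⟩ = 0 :=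
      congrArg (fun E : Derivation ℂ (sectionRing (1 : FractionRing R) 0)
        (sectionRing (1 : FractionRing R) 0) => E ⟨_, C_pow_mul_X_mem_sectionRing 1 le_rfl⟩) h0
    have h2 := congrArg Subtype.val h1
    change Δ _ = 0 at h2
    rw [hΔX 0 le_rfl] at h2
    exact one_ne_zero h2
  · exact killsFraction_restrictDerivation h (hΔC x)

theorem exists_algebraMap_ne_zero {D : Derivation ℂ (FractionRing R) (FractionRing R)}
    (hD : D ≠ 0) : ∃ a : R, D (algebraMap R _ a) ≠ 0 := by
  by_contra! h
  apply hD
  ext x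
  obtain ⟨a, b, hb, rfl⟩ := IsFractionRing.div_surjective (A := R) x
  have hb0 : algebraMap R (FractionRing R) b ≠ 0 := by
    rw [Ne, map_eq_zero_iff _ (IsFractionRing.injective _ _)]
    exact nonZeroDivisors.ne_zero hb
  rw [div_eq_mul_inv, D.leibniz, Derivation.leibniz_inv, h, h]
  simp

theorem exists_lineBundle_of_isMorphismToP1 [Algebra.FiniteType ℂ R]
    {D : Derivation ℂ (FractionRing R) (FractionRing R)} (hD : IsGLND R D) (hD0 : D ≠ 0)
    {f : FractionRing R} (hf0 : f ≠ 0) (hf : constants D = IntermediateField.adjoin ℂ {f})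
    (hfm : IsMorphismToP1 f) :
    ∃ (L : LineBundle R) (D' : Derivation ℂ L.total L.total),
      IsLocallyNilpotent D' ∧ (∀ h, D h = 0 → KillsFraction D' (L.pullback h)) ∧
      (∃ m : ℕ, 1 ≤ m ∧ L.IsAssociated (fun p => -(m : ℤ) * polarDivisor f p)) ∧
      ∃ a : R, D' (algebraMap R L.total a) ≠ 0 := by
  have : IsNoetherianRing R := Algebra.FiniteType.isNoetherianRing ℂ R
  have : CharZero R := charZero_of_injective_algebraMap (algebraMap ℂ R).injective
  obtain ⟨c⟩ := hfm.nonempty_cover hf0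
  obtain ⟨f₀, hf₀, hstab⟩ := hD
  have hDf : D f = 0 := by
    have : f ∈ constants D := hf ▸ IntermediateField.mem_adjoin_simple_self ℂ f
    exact this
  have hf₀' : f₀ ∈ IntermediateField.adjoin ℂ {f} := hf ▸ hf₀
  obtain ⟨q, m, hq0, hDq, hm, hq⟩ := exists_clearing_denominators hDf hf₀'
    fun r => (hstab _ (Subalgebra.algebraMap_mem _ r)).1
  -- The factor `X` moves `q D(r)` into the fibre-linear part of the ring, where powers of `f` up to
  -- `m` are available.
  let Δ : Derivation ℂ (FractionRing R)[X] (FractionRing R)[X] := (C q * X) • coeffDerivation D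
  have hΔC : ∀ x, Δ (C x) = C (q * D x) * X := fun x => by
    change C q * X * coeffDerivation D (C x) = _
    rw [coeffDerivation_C, C_mul]
    ring
  have hΔX : ∀ i, Δ (C (f ^ i) * X) = 0 := fun i => by
    change C q * X * coeffDerivation D (C (f ^ i) * X) = _
    rw [Derivation.leibniz, coeffDerivation_C, coeffDerivation_X, D.leibniz_pow, hDf]
    simp
  have hiter : ∀ (n : ℕ) x, Δ^[n] (C x) = C (q ^ n * D^[n] x) * X ^ n := by
    intro n x
    induction n with
    | zero => simp
    | succ n ih =>
      rw [Function.iterate_succ_apply', ih, Function.iterate_succ_apply']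
      have hqn : D (q ^ n) = 0 :=
        pow_mem (mem_constants.mpr hDq) n
      change C q * X * coeffDerivation D (C (q ^ n * D^[n] x) * X ^ n) = _
      rw [Derivation.leibniz, coeffDerivation_C, coeffDerivation_X_pow, D.leibniz,
        hqn, smul_zero, smul_zero, add_zero, zero_add]
      simp only [smul_eq_mul, C_mul, C_pow]
      ring
  have h : ∀ p ∈ sectionRing f m, Δ p ∈ sectionRing f m := fun p hp =>
    derivation_mem_sectionRing (fun r => by rw [hΔC]; exact hq r)
      (fun i _ => by rw [hΔX]; exact zero_mem _) hp
  refine ⟨c.bundle m, restrictDerivation h, ?_, fun x hx => ?_, ⟨m, hm, c.isAssociated m⟩, ?_⟩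
  · refine restrictDerivation_isLocallyNilpotent h fun p hp =>
      exists_iterate_eq_zero_of_mem_sectionRing (fun r => ?_) (fun i hi => ⟨1, hΔX i⟩) hp
    obtain ⟨n, hn⟩ := (hstab _ (Subalgebra.algebraMap_mem _ r)).2
    exact ⟨n, by rw [hiter, hn, mul_zero, C_0, zero_mul]⟩
  · exact killsFraction_restrictDerivation h (by rw [hΔC, hx, mul_zero, C_0, zero_mul])
  · obtain ⟨a, ha⟩ := exists_algebraMap_ne_zero hD0
    refine ⟨a, fun h0 => mul_ne_zero hq0 ha ?_⟩
    have h1 : Δ (C (algebraMap R _ a)) = 0 := congrArg Subtype.val h0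
    rw [hΔC, mul_eq_zero, or_iff_left X_ne_zero, C_eq_zero] at h1
    exact h1

end Main

end GMLBundle

theorem mainTheorem4 (R : Type) [CommRing R] [IsDomain R] [Algebra ℂ R]
    (hS : GMLBundle.IsRigidSurface R)
    (D : Derivation ℂ (FractionRing R) (FractionRing R)) (hD : GMLBundle.IsGLND R D) :
    ∃ (L : GMLBundle.LineBundle R) (D' : Derivation ℂ L.total L.total),
      GMLBundle.IsLocallyNilpotent D' ∧ D' ≠ 0 ∧
      (∀ h : FractionRing R, D h = 0 → GMLBundle.KillsFraction D' (L.pullback h)) ∧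
      (D ≠ 0 → ∃ f : FractionRing R,
        {h : FractionRing R | D h = 0} = (IntermediateField.adjoin ℂ {f} : Set (FractionRing R)) ∧
        (GMLBundle.IsMorphismToP1 f →
          (∃ m : ℕ, 1 ≤ m ∧ L.IsAssociated (fun p => -(m : ℤ) * GMLBundle.polarDivisor f p)) ∧
          ∃ a : R, D' (algebraMap R L.total a) ≠ 0)) := by
  obtain ⟨L, D', hnil, hne, hkill⟩ := GMLBundle.exists_lineBundle_kills_pullback R
  by_cases hD0 : D = 0
  · exact ⟨L, D', hnil, hne, fun h _ => hkill h, fun h => absurd hD0 h⟩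
  obtain ⟨e⟩ := hS.rational
  obtain ⟨f, hf0, hf⟩ := GMLBundle.exists_constants_eq_adjoin e hD0
  have hset : {h : FractionRing R | D h = 0} =
      (IntermediateField.adjoin ℂ {f} : Set (FractionRing R)) := congrArg SetLike.coe hf
  -- The bundle may be chosen after `f`; when `f` is not a morphism, the trivial bundle meets the
  -- remaining demands.
  by_cases hfm : GMLBundle.IsMorphismToP1 f
  · have := hS.smooth
    obtain ⟨L, D', hnil, hkill, hass, a, ha⟩ :=
      GMLBundle.exists_lineBundle_of_isMorphismToP1 hD hD0 hf0 hf hfm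
    refine ⟨L, D', hnil, fun h0 => ha ?_, hkill, fun _ => ⟨f, hset, fun _ => ⟨hass, a, ha⟩⟩⟩
    rw [h0]
    rfl
  · exact ⟨L, D', hnil, hne, fun h _ => hkill h, fun _ => ⟨f, hset, fun h => absurd h hfm⟩⟩
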